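/- Let $(E,\mathcal E)$ be a countably generated measurable space whose diagonal $\{(x,x):x\in E\}$ belongs to $\mathcal E\otimes\mathcal E$. For probability measures, write $\mu\sim\nu$ if $\mu$ and $\nu$ are mutually absolutely continuous, and let $\|\mu-\nu\|$ denote the total variation of the signed measure $\mu-\nu$. (a) Discrete time. Let $P(x,dy)$ be the transition kernel of a Markov chain on $(E,\mathcal E)$, with $n$-step transition probabilities $P_n(x,dy)$, and assume that for each $x,y\in E$ there exists $n=n_{x,y}$ such that $P_n(x,\cdot)\sim P_n(y,\cdot)$. Then there is at most one invariant probability measure for the chain, i.e. at most one probability measure $\mu$ on $(E,\mathcal E)$ with $\mu(dy)=\int_E P(x,dy)\,\mu(dx)$. If an invariant probability measure $\mu$ exists, then for every $x\in E$ $$\|P_n(x,\cdot)-\mu\|\to 0,\qquad n\to\infty.$$ (b) Continuous time. Let $(P_t)_{t\ge 0}$ be a Markov semigroup of transition kernels on $(E,\mathcal E)$, that is, each $P_t$ is a Markov kernel, $P_0(x,\cdot)=\delta_x$ and $P_{s+t}(x,\cdot)=\int_E P_t(y,\cdot)\,P_s(x,dy)$ for all $s,t\ge 0$ and $x\in E$;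 no regularity in $t$ is required. Assume that for each $x,y\in E$ there exists $t=t_{x,y}\ge 0$ such that $P_t(x,\cdot)\sim P_t(y,\cdot)$. Then there is at most one probability measure $\mu$ on $(E,\mathcal E)$ that is invariant for every $P_t$, $t\ge 0$. If such a $\mu$ exists, then for every $x\in E$ $$\|P_t(x,\cdot)-\mu\|\to 0,\qquad t\to\infty.$$ -/

import Mathlib

open MeasureTheory ProbabilityTheory Filter Topology
open scoped NNReal ENNReal

/-- The total variation distance between two finite measures: the total variation (total mass)
of the signed measure `μ - ν`. In particular it equals `2` for mutually singular probability
measures. -/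
noncomputable def tvDist {E : Type*} [MeasurableSpace E] (μ ν : Measure E)
    [IsFiniteMeasure μ] [IsFiniteMeasure ν] : ℝ≥0∞ :=
  (μ.toSignedMeasure - ν.toSignedMeasure).totalVariation Set.univ

/-- Equivalence of measures: each is absolutely continuous with respect to the other. -/
def MeasEquiv {E : Type*} [MeasurableSpace E] (μ ν : Measure E) : Prop :=
  μ ≪ ν ∧ ν ≪ μ

/-- The `n`-step transition probabilities of a Markov chain are probability kernels. Here `P ^ n`
is the `n`-fold composition of `P`, with `(P ^ 0) x` the Dirac measure at `x`. -/
instance isMarkovKernel_pow {E : Type*} [MeasurableSpace E] (P : Kernel E E) [IsMarkovKernel P]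
    (n : ℕ) : IsMarkovKernel (P ^ n) := by
  induction n with
  | zero => exact inferInstanceAs (IsMarkovKernel (Kernel.id : Kernel E E))
  | succ k ih =>
    rw [pow_succ]
    exact inferInstanceAs (IsMarkovKernel ((P ^ k) ∘ₖ P))

/-- The semigroup property of a family of transition kernels in continuous time `t ≥ 0`:
`P 0` is the identity kernel, and the Chapman-Kolmogorov equations hold. No regularity in `t`
is required. -/
structure IsKernelSemigroup {E : Type*} [MeasurableSpace E] (P : ℝ≥0 → Kernel E E) : Prop where
  zero : P 0 = Kernel.id
  add : ∀ s t : ℝ≥0, P (s + t) = P t ∘ₖ P s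

/-! For equal masses, total variation is twice the mass of the truncated difference, and Markov
kernels do not increase that mass. Hence for two laws evolved to time n it decreases to a limit c.
If both laws are at most M • μ with μ invariant, they stay so. For k large, all pairs of points
outside a set of small μ ⊗ μ measure δ have k-step laws overlapping by some ε. Averaging over pairs
drawn from the two excess parts at time n gives D n * D (n + k) ≤ (1 - ε) * D n ^ 2 + ε * M ^ 2 * δ
(`mul_comp_sub_univ_le`). In the limit c ^ 2 ≤ M ^ 2 * δ for every δ > 0, so c = 0
(`tendsto_pow_comp_sub`). From any x the chain becomes absolutely continuous with respect to μ
(`exists_pow_absolutelyContinuous`), and truncating the density reduces to the bounded case.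
Uniqueness follows by the triangle inequality; continuous time follows from the skeleton `P 1 ^ n`
and monotonicity in t. -/

namespace MarkovTV

variable {E : Type*} [MeasurableSpace E]

/-! ### Truncated differences of measures and total variation. -/

lemma comp_mono (κ : Kernel E E) {μ ν : Measure E} (h : μ ≤ ν) : κ ∘ₘ μ ≤ κ ∘ₘ ν := by
  refine Measure.le_iff.2 fun s hs => ?_
  rw [Measure.bind_apply hs κ.aemeasurable, Measure.bind_apply hs κ.aemeasurable]
  exact lintegral_mono' h le_rfl

lemma le_sub_add (μ ν : Measure E) [IsFiniteMeasure μ] [IsFiniteMeasure ν] : μ ≤ μ - ν + ν :=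
  Measure.sub_le_iff_le_add.1 le_rfl

lemma comp_univ (κ : Kernel E E) [IsMarkovKernel κ] (μ : Measure E) :
    (κ ∘ₘ μ) Set.univ = μ Set.univ := by
  rw [Measure.bind_apply .univ κ.aemeasurable]
  simp

lemma comp_sub_le (κ : Kernel E E) (μ ν : Measure E) [IsFiniteMeasure μ] [IsFiniteMeasure ν] :
    κ ∘ₘ μ - κ ∘ₘ ν ≤ κ ∘ₘ (μ - ν) := by
  refine Measure.sub_le_of_le_add ?_
  rw [← Measure.comp_add]
  exact comp_mono κ (le_sub_add μ ν)

lemma comp_sub_univ_le (κ : Kernel E E) [IsMarkovKernel κ] (μ ν : Measure E) [IsFiniteMeasure μ]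
    [IsFiniteMeasure ν] : (κ ∘ₘ μ - κ ∘ₘ ν) Set.univ ≤ (μ - ν) Set.univ :=
  (comp_sub_le κ μ ν Set.univ).trans_eq (comp_univ κ _)

/-- Where μ ≤ ν, both sides reduce to ν. -/
lemma restrict_sub_add_comm {μ ν : Measure E} [IsFiniteMeasure μ] [IsFiniteMeasure ν] {s : Set E}
    (hs : IsHahnDecomposition μ ν s) :
    (μ - ν + ν).restrict s = (ν - μ + μ).restrict s := by
  simp only [Measure.restrict_add, Measure.restrict_sub_eq_restrict_sub_restrict hs.measurableSet,
    Measure.sub_eq_zero_of_le hs.le_on, Measure.sub_add_cancel_of_le hs.le_on, zero_add]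

lemma sub_add_comm (μ ν : Measure E) [IsFiniteMeasure μ] [IsFiniteMeasure ν] :
    μ - ν + ν = ν - μ + μ := by
  obtain ⟨s, hs⟩ := exists_isHahnDecomposition μ ν
  rw [← Measure.restrict_add_restrict_compl (μ := μ - ν + ν) hs.measurableSet,
    ← Measure.restrict_add_restrict_compl (μ := ν - μ + μ) hs.measurableSet,
    restrict_sub_add_comm hs, restrict_sub_add_comm hs.compl]

lemma sub_univ_comm {μ ν : Measure E} [IsFiniteMeasure μ] [IsFiniteMeasure ν]
    (h : μ Set.univ = ν Set.univ) : (μ - ν) Set.univ = (ν - μ) Set.univ := by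
  have := congrArg (fun ρ : Measure E => ρ Set.univ) (sub_add_comm μ ν)
  simp only [Measure.add_apply, h] at this
  exact (ENNReal.add_left_inj (measure_ne_top ν _)).1 this

lemma exists_sub_univ_add_eq (μ ν : Measure E) [IsFiniteMeasure μ] [IsFiniteMeasure ν] :
    ∃ A, MeasurableSet A ∧ (μ - ν) Set.univ + ν A = μ A := by
  obtain ⟨s, hs⟩ := exists_isHahnDecomposition μ ν
  refine ⟨sᶜ, hs.measurableSet.compl, ?_⟩
  rw [← measure_add_measure_compl hs.measurableSet,
    Measure.sub_apply_eq_zero_of_isHahnDecomposition hs, zero_add,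
    ← Measure.restrict_apply_univ (μ := μ - ν), ← Measure.restrict_apply_univ (μ := ν),
    ← Measure.restrict_apply_univ (μ := μ), ← Measure.add_apply,
    Measure.restrict_sub_eq_restrict_sub_restrict hs.measurableSet.compl,
    Measure.sub_add_cancel_of_le hs.ge_on_compl]

lemma tvDist_eq (μ ν : Measure E) [IsFiniteMeasure μ] [IsFiniteMeasure ν] :
    tvDist μ ν = (μ - ν) Set.univ + (ν - μ) Set.univ := by
  simp [tvDist, SignedMeasure.totalVariation,
    Measure.jordanDecompositionOfToSignedMeasureSub_posPart,
    Measure.jordanDecompositionOfToSignedMeasureSub_negPart]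

lemma tvDist_eq_two_mul {μ ν : Measure E} [IsFiniteMeasure μ] [IsFiniteMeasure ν]
    (h : μ Set.univ = ν Set.univ) : tvDist μ ν = 2 * (μ - ν) Set.univ := by
  rw [tvDist_eq, ← sub_univ_comm h, two_mul]

lemma eq_of_sub_univ_eq_zero {μ ν : Measure E} [IsFiniteMeasure μ] [IsFiniteMeasure ν]
    (h : μ Set.univ = ν Set.univ) (h0 : (μ - ν) Set.univ = 0) : μ = ν := by
  have h1 : μ - ν = 0 := Measure.measure_univ_eq_zero.1 h0
  have h2 : ν - μ = 0 := Measure.measure_univ_eq_zero.1 (sub_univ_comm h ▸ h0)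
  simpa [h1, h2] using (sub_add_comm μ ν).symm

/-- A difference of mass 1 would be attained on a set that is null for ν and full for μ. -/
lemma sub_univ_lt_one {μ ν : Measure E} [IsProbabilityMeasure μ] [IsProbabilityMeasure ν]
    (h : μ ≪ ν) : (μ - ν) Set.univ < 1 := by
  obtain ⟨A, -, hAeq⟩ := exists_sub_univ_add_eq μ ν
  by_contra! h1
  have h2 : 1 + ν A ≤ 1 + 0 := by
    calc 1 + ν A ≤ (μ - ν) Set.univ + ν A := by gcongr
      _ = μ A := hAeq
      _ ≤ 1 + 0 := by simpa using prob_le_one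
  have h3 : ν A = 0 := by simpa using (ENNReal.add_le_add_iff_left ENNReal.one_ne_top).1 h2
  rw [h3, h h3, add_zero] at hAeq
  simp [hAeq] at h1

/-- The part common to μ and ν cancels, so only the two excess parts need to be compared after
applying κ. -/
lemma comp_sub_le_comp_sub_comp (κ : Kernel E E) [IsMarkovKernel κ] (μ ν : Measure E)
    [IsFiniteMeasure μ] [IsFiniteMeasure ν] :
    κ ∘ₘ μ - κ ∘ₘ ν ≤ κ ∘ₘ (μ - ν) - κ ∘ₘ (ν - μ) := by
  refine Measure.sub_le_of_le_add ?_
  refine Measure.le_of_add_le_add_left (μ := κ ∘ₘ (ν - μ)) ?_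
  calc κ ∘ₘ (ν - μ) + κ ∘ₘ μ = κ ∘ₘ (μ - ν) + κ ∘ₘ ν := by
        rw [← Measure.comp_add, ← Measure.comp_add, sub_add_comm]
    _ ≤ κ ∘ₘ (μ - ν) - κ ∘ₘ (ν - μ) + κ ∘ₘ (ν - μ) + κ ∘ₘ ν := by
        gcongr; exact le_sub_add _ _
    _ = κ ∘ₘ (ν - μ) + (κ ∘ₘ (μ - ν) - κ ∘ₘ (ν - μ) + κ ∘ₘ ν) := by
        rw [add_comm _ (κ ∘ₘ (ν - μ)), add_assoc]

/-! ### Contraction by averaging over pairs of points. -/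

/-- If `κ x` and `κ y` overlap by at least `ε` for most pairs `(x, y)`, then `κ` contracts the
difference of two measures of mass `m` with bounded densities. -/
lemma mul_comp_sub_univ_le (κ : Kernel E E) [IsMarkovKernel κ] {μ γ η : Measure E}
    [IsProbabilityMeasure μ] [IsFiniteMeasure γ] [IsFiniteMeasure η] {m M ε δ : ℝ≥0∞}
    (hγm : γ Set.univ = m) (hηm : η Set.univ = m) (hM : M ≠ ∞) (hγ : γ ≤ M • μ) (hη : η ≤ M • μ)
    {G : Set (E × E)} (hG : ∀ p ∈ G, (κ p.1 - κ p.2) Set.univ + ε ≤ 1) (hGδ : 1 ≤ μ.prod μ G + δ) :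
    m * (κ ∘ₘ γ - κ ∘ₘ η) Set.univ + ε * (m * m) ≤ m * m + ε * (M * M * δ) := by
  have hm : m ≠ ∞ := hγm ▸ measure_ne_top γ _
  obtain ⟨A, hA, hAeq⟩ := exists_sub_univ_add_eq (κ ∘ₘ γ) (κ ∘ₘ η)
  have hκ : Measurable fun x => κ x A := κ.measurable_coe hA
  have hκ1 : Measurable fun p : E × E => κ p.1 A := hκ.comp measurable_fst
  have hκ2 : Measurable fun p : E × E => κ p.2 A := hκ.comp measurable_snd
  -- G need not be measurable; S is a measurable superset on which the overlap estimate holds for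
  -- the single set A.
  set S : Set (E × E) := {p | κ p.1 A + ε ≤ κ p.2 A + 1} with hS
  have hSm : MeasurableSet S := measurableSet_le (hκ1.add_const ε) (hκ2.add_const 1)
  have hGS : G ⊆ S := by
    intro p hp
    calc κ p.1 A + ε ≤ (κ p.1 - κ p.2 + κ p.2) A + ε := by
          gcongr; exact le_sub_add _ _
      _ ≤ (κ p.1 - κ p.2) Set.univ + κ p.2 A + ε := by
          rw [Measure.add_apply]; gcongr; exact Set.subset_univ A
      _ = κ p.2 A + ((κ p.1 - κ p.2) Set.univ + ε) := by ring
      _ ≤ κ p.2 A + 1 := by gcongr; exact hG p hp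
  have hSc : μ.prod μ Sᶜ ≤ δ := by
    rw [prob_compl_eq_one_sub hSm, tsub_le_iff_left]
    exact hGδ.trans (by gcongr)
  have hSc' : γ.prod η Sᶜ ≤ M * M * δ := by
    have : IsFiniteMeasure (M • μ) := μ.smul_finite hM
    calc γ.prod η Sᶜ ≤ (M • μ).prod (M • μ) Sᶜ := Measure.prod_mono hγ hη _
      _ = M * M * μ.prod μ Sᶜ := by
        rw [Measure.prod_smul_left, Measure.prod_smul_right]
        simp [mul_assoc]
      _ ≤ M * M * δ := by gcongr
  have hpt : ∀ p : E × E,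
      κ p.1 A + ε ≤ κ p.2 A + 1 + Sᶜ.indicator (fun _ => ε) p := by
    intro p
    by_cases hp : p ∈ S
    · exact le_add_right hp
    · rw [Set.indicator_of_mem (by exact hp)]
      have : κ p.1 A ≤ 1 := prob_le_one
      gcongr
      exact this.trans le_add_self
  have hint := lintegral_mono (μ := γ.prod η) hpt
  have h1 : ∫⁻ p, κ p.1 A ∂(γ.prod η) = (κ ∘ₘ γ) A * m := by
    rw [Measure.bind_apply hA κ.aemeasurable, ← hηm]
    have := lintegral_prod_mul (μ := γ) (ν := η) hκ.aemeasurable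
      (aemeasurable_const (b := (1 : ℝ≥0∞)))
    simpa using this
  have h2 : ∫⁻ p, κ p.2 A ∂(γ.prod η) = m * (κ ∘ₘ η) A := by
    rw [Measure.bind_apply hA κ.aemeasurable, ← hγm]
    have := lintegral_prod_mul (μ := γ) (ν := η)
      (aemeasurable_const (b := (1 : ℝ≥0∞))) hκ.aemeasurable
    simpa using this
  have h3 : γ.prod η Set.univ = m * m := by
    rw [← Set.univ_prod_univ, Measure.prod_prod, hγm, hηm]
  rw [lintegral_add_left hκ1, lintegral_add_left (hκ2.add_const 1), lintegral_add_left hκ2,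
    lintegral_indicator_const hSm.compl, lintegral_const, lintegral_const, h1, h2, h3, ← hAeq,
    one_mul] at hint
  have hfin : m * (κ ∘ₘ η) A ≠ ∞ := ENNReal.mul_ne_top hm (measure_ne_top _ _)
  refine (ENNReal.add_le_add_iff_left hfin).1 ?_
  calc m * (κ ∘ₘ η) A + (m * (κ ∘ₘ γ - κ ∘ₘ η) Set.univ + ε * (m * m))
      = ((κ ∘ₘ γ - κ ∘ₘ η) Set.univ + (κ ∘ₘ η) A) * m + ε * (m * m) := by ring
    _ ≤ m * (κ ∘ₘ η) A + m * m + ε * γ.prod η Sᶜ := hint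
    _ ≤ m * (κ ∘ₘ η) A + m * m + ε * (M * M * δ) := by gcongr
    _ = m * (κ ∘ₘ η) A + (m * m + ε * (M * M * δ)) := by ring

/-! ### Iterates, overlapping pairs and merging of bounded densities. -/

lemma pow_comp (P : Kernel E E) (μ : Measure E) (m n : ℕ) :
    (P ^ (m + n)) ∘ₘ μ = (P ^ n) ∘ₘ ((P ^ m) ∘ₘ μ) := by
  rw [Measure.comp_assoc, add_comm, Kernel.pow_add]

lemma pow_add_apply (P : Kernel E E) (x : E) (m n : ℕ) :
    (P ^ (m + n)) x = (P ^ n) ∘ₘ ((P ^ m) x) := by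
  rw [add_comm, Kernel.pow_add, Kernel.comp_apply]

lemma invariant_pow {P : Kernel E E} {μ : Measure E} (h : Kernel.Invariant P μ) (n : ℕ) :
    (P ^ n) ∘ₘ μ = μ := by
  induction n with
  | zero => exact Measure.bind_dirac
  | succ k ih => rw [add_comm, pow_comp, pow_one]; erw [h.def]; exact ih

lemma antitone_pow_comp_sub (P : Kernel E E) [IsMarkovKernel P] (α β : Measure E)
    [IsFiniteMeasure α] [IsFiniteMeasure β] :
    Antitone fun n : ℕ => ((P ^ n) ∘ₘ α - (P ^ n) ∘ₘ β) Set.univ := by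
  refine antitone_nat_of_succ_le fun n => ?_
  rw [pow_comp, pow_comp]
  exact comp_sub_univ_le _ _ _

lemma antitone_pow_apply_sub (P : Kernel E E) [IsMarkovKernel P] (x y : E) :
    Antitone fun n : ℕ => ((P ^ n) x - (P ^ n) y) Set.univ := by
  refine antitone_nat_of_succ_le fun n => ?_
  rw [pow_add_apply, pow_add_apply]
  exact comp_sub_univ_le _ _ _

/-- The pairs of points whose `k`-step transition probabilities overlap by at least
`1 / (k + 1)`. -/
def overlapSet (P : Kernel E E) (k : ℕ) : Set (E × E) :=
  {p | ((P ^ k) p.1 - (P ^ k) p.2) Set.univ + ((k : ℝ≥0∞) + 1)⁻¹ ≤ 1}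

lemma monotone_overlapSet (P : Kernel E E) [IsMarkovKernel P] : Monotone (overlapSet P) := by
  intro k l hkl p hp
  refine le_trans ?_
    (show ((P ^ k) p.1 - (P ^ k) p.2) Set.univ + ((k : ℝ≥0∞) + 1)⁻¹ ≤ 1 from hp)
  have := antitone_pow_apply_sub P p.1 p.2 hkl
  have h2 : (k : ℝ≥0∞) ≤ l := by exact_mod_cast hkl
  dsimp only at this
  gcongr

lemma iUnion_overlapSet {P : Kernel E E} [IsMarkovKernel P]
    (h : ∀ x y : E, ∃ n : ℕ, (P ^ n) x ≪ (P ^ n) y) : ⋃ k, overlapSet P k = Set.univ := by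
  refine Set.eq_univ_of_forall fun p => ?_
  obtain ⟨n, hn⟩ := h p.1 p.2
  have h1 := sub_univ_lt_one hn
  obtain ⟨j, hj⟩ := ENNReal.exists_inv_nat_lt (tsub_pos_iff_lt.2 h1).ne'
  -- One index serves both as number of steps and as threshold: increasing it shrinks both terms.
  refine Set.mem_iUnion.2 ⟨max n j, ?_⟩
  have h2 := antitone_pow_apply_sub P p.1 p.2 (le_max_left n j)
  have h3 : (j : ℝ≥0∞) ≤ (max n j : ℕ) + 1 :=
    le_add_right (by exact_mod_cast le_max_right n j)
  dsimp only at h2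
  calc ((P ^ (max n j)) p.1 - (P ^ (max n j)) p.2) Set.univ + (((max n j : ℕ) : ℝ≥0∞) + 1)⁻¹
      ≤ ((P ^ n) p.1 - (P ^ n) p.2) Set.univ + (1 - ((P ^ n) p.1 - (P ^ n) p.2) Set.univ) := by
        gcongr
        exact (ENNReal.inv_le_inv.2 h3).trans hj.le
    _ = 1 := add_tsub_cancel_of_le h1.le

lemma exists_overlapSet_large {P : Kernel E E} [IsMarkovKernel P]
    (h : ∀ x y : E, ∃ n : ℕ, (P ^ n) x ≪ (P ^ n) y) (μ : Measure E) [IsProbabilityMeasure μ]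
    {δ : ℝ≥0∞} (hδ : δ ≠ 0) : ∃ k, 1 ≤ μ.prod μ (overlapSet P k) + δ := by
  have hsup : ⨆ k, μ.prod μ (overlapSet P k) = 1 := by
    rw [← (monotone_overlapSet P).measure_iUnion, iUnion_overlapSet h, measure_univ]
  have hlt : 1 - δ < ⨆ k, μ.prod μ (overlapSet P k) := by
    rw [hsup]
    exact ENNReal.sub_lt_self ENNReal.one_ne_top one_ne_zero hδ
  obtain ⟨k, hk⟩ := lt_iSup_iff.1 hlt
  exact ⟨k, tsub_le_iff_right.1 hk.le⟩

/-- Measures of equal mass with bounded densities with respect to an invariant probability measure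
merge under the iterates of the kernel. -/
lemma tendsto_pow_comp_sub {P : Kernel E E} [IsMarkovKernel P]
    (h : ∀ x y : E, ∃ n : ℕ, (P ^ n) x ≪ (P ^ n) y) {μ α β : Measure E} [IsProbabilityMeasure μ]
    [IsFiniteMeasure α] [IsFiniteMeasure β] (hμ : Kernel.Invariant P μ)
    (hαβ : α Set.univ = β Set.univ) {M : ℝ≥0∞} (hM : M ≠ ∞) (hα : α ≤ M • μ) (hβ : β ≤ M • μ) :
    Tendsto (fun n : ℕ => ((P ^ n) ∘ₘ α - (P ^ n) ∘ₘ β) Set.univ) atTop (𝓝 0) := by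
  set D : ℕ → ℝ≥0∞ := fun n => ((P ^ n) ∘ₘ α - (P ^ n) ∘ₘ β) Set.univ with hD
  have hDlim : Tendsto D atTop (𝓝 (⨅ n, D n)) := tendsto_atTop_iInf (antitone_pow_comp_sub P α β)
  set c := ⨅ n, D n with hc
  have hcfin : c ≠ ∞ := ne_top_of_le_ne_top (measure_ne_top _ _) (iInf_le D 0)
  have hbound : ∀ (ρ : Measure E) (n : ℕ), ρ ≤ M • μ → (P ^ n) ∘ₘ ρ ≤ M • μ := by
    intro ρ n hρ
    refine (comp_mono (P ^ n) hρ).trans_eq ?_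
    rw [Measure.comp_smul, invariant_pow hμ]
  have hstep : ∀ δ : ℝ≥0∞, δ ≠ 0 → c * c ≤ M * M * δ := by
    intro δ hδ
    obtain ⟨k, hk⟩ := exists_overlapSet_large h μ hδ
    set ε : ℝ≥0∞ := ((k : ℝ≥0∞) + 1)⁻¹ with hε
    have hε1 : ε ≤ 1 := ENNReal.inv_le_one.2 le_add_self
    have hε0 : ε ≠ 0 := ENNReal.inv_ne_zero.2 (by finiteness)
    have hεt : ε ≠ ∞ := ne_top_of_le_ne_top ENNReal.one_ne_top hε1
    have hineq : ∀ n, D n * D (n + k) + ε * (D n * D n) ≤ D n * D n + ε * (M * M * δ) := by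
      intro n
      have hmass : ((P ^ n) ∘ₘ α) Set.univ = ((P ^ n) ∘ₘ β) Set.univ := by
        rw [comp_univ, comp_univ, hαβ]
      -- The two excess parts at time n both have mass `D n`.
      refine le_trans ?_ (mul_comp_sub_univ_le (P ^ k) (μ := μ)
        (γ := (P ^ n) ∘ₘ α - (P ^ n) ∘ₘ β) (η := (P ^ n) ∘ₘ β - (P ^ n) ∘ₘ α) rfl
        (sub_univ_comm hmass).symm hM (Measure.sub_le.trans (hbound α n hα))
        (Measure.sub_le.trans (hbound β n hβ)) (G := overlapSet P k) (fun p hp => hp) hk)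
      gcongr
      simp only [hD, pow_comp]
      exact comp_sub_le_comp_sub_comp _ _ _ _
    have hsq : Tendsto (fun n => D n * D n) atTop (𝓝 (c * c)) :=
      ENNReal.Tendsto.mul hDlim (.inr hcfin) hDlim (.inr hcfin)
    have hlim := le_of_tendsto_of_tendsto'
      ((ENNReal.Tendsto.mul hDlim (.inr hcfin) ((tendsto_add_atTop_iff_nat k).2 hDlim)
        (.inr hcfin)).add (ENNReal.Tendsto.const_mul hsq (.inr hεt)))
      (hsq.add tendsto_const_nhds) hineq
    have := (ENNReal.add_le_add_iff_left (ENNReal.mul_ne_top hcfin hcfin)).1 hlim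
    exact (ENNReal.mul_le_mul_iff_right hε0 hεt).1 this
  have hc0 : c = 0 := by
    by_contra hne
    have hcc : c * c ≠ 0 := mul_ne_zero hne hne
    have hMM : M * M ≠ ∞ := ENNReal.mul_ne_top hM hM
    obtain ⟨δ, hδ0, hδ⟩ : ∃ δ : ℝ≥0∞, δ ≠ 0 ∧ M * M * δ < c * c := by
      have ht : Tendsto (fun δ : ℝ≥0∞ => M * M * δ) (𝓝[>] 0) (𝓝 (M * M * 0)) :=
        (ENNReal.Tendsto.const_mul tendsto_id (.inr hMM)).mono_left nhdsWithin_le_nhds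
      rw [mul_zero] at ht
      obtain ⟨δ, h1, h2⟩ := ((ht.eventually (gt_mem_nhds (pos_iff_ne_zero.2 hcc))).and
        self_mem_nhdsWithin).exists
      exact ⟨δ, (Set.mem_Ioi.1 h2).ne', h1⟩
    exact absurd (hstep δ hδ0) hδ.not_ge
  rwa [hc0] at hDlim

/-! ### Absolute continuity, convergence and uniqueness in discrete time. -/

lemma exists_pow_absolutelyContinuous {P : Kernel E E} [IsMarkovKernel P]
    (h : ∀ x y : E, ∃ n : ℕ, (P ^ n) x ≪ (P ^ n) y) {μ : Measure E} [IsProbabilityMeasure μ]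
    (hμ : Kernel.Invariant P μ) (x : E) : ∃ n : ℕ, (P ^ n) x ≪ μ := by
  have hU : ⋃ n : ℕ, {y | (P ^ n) x ≪ (P ^ n) y} = Set.univ :=
    Set.eq_univ_of_forall fun y => Set.mem_iUnion.2 (h x y)
  -- Countably many sets cover E, so one has positive outer measure. This fixes n before A is
  -- chosen, and the set then meets every set of full μ-measure.
  obtain ⟨n, hn⟩ : ∃ n : ℕ, μ {y | (P ^ n) x ≪ (P ^ n) y} ≠ 0 := by
    by_contra! h0
    have := measure_iUnion_null h0
    simp [hU] at this
  refine ⟨n, Measure.AbsolutelyContinuous.mk fun A hA hA0 => ?_⟩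
  have hae : ∀ᵐ y ∂μ, (P ^ n) y A = 0 := by
    rw [← invariant_pow hμ n, Measure.bind_apply hA (P ^ n).aemeasurable,
      lintegral_eq_zero_iff ((P ^ n).measurable_coe hA)] at hA0
    exact hA0
  obtain ⟨y, hy, hyA⟩ := Frequently.exists
    (Frequently.and_eventually (frequently_ae_iff.2 hn) hae)
  exact hy hyA

lemma exists_le_smul_of_absolutelyContinuous {μ ν : Measure E} [IsProbabilityMeasure μ]
    [IsFiniteMeasure ν] (h : ν ≪ μ) {ε : ℝ≥0∞} (hε : ε ≠ 0) :
    ∃ (ρ : Measure E) (M : ℕ), ρ ≤ ν ∧ ρ ≤ (M : ℝ≥0∞) • μ ∧ ν Set.univ ≤ ρ Set.univ + ε := by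
  set f := ν.rnDeriv μ with hf
  have hfm : Measurable f := Measure.measurable_rnDeriv ν μ
  have hν : μ.withDensity f = ν := Measure.withDensity_rnDeriv_eq ν μ h
  have hsup : ⨆ M : ℕ, ∫⁻ x, min (f x) M ∂μ = ν Set.univ := by
    rw [← lintegral_iSup (fun M => hfm.min measurable_const), ← hν, withDensity_apply _ .univ,
      Measure.restrict_univ]
    · refine lintegral_congr fun x => ?_
      rw [← inf_iSup_eq, ENNReal.iSup_natCast, inf_top_eq]
    · intro M N hMN x
      have : (M : ℝ≥0∞) ≤ N := by exact_mod_cast hMN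
      dsimp only
      gcongr
  obtain ⟨M, hM⟩ : ∃ M : ℕ, ν Set.univ ≤ ∫⁻ x, min (f x) M ∂μ + ε := by
    by_cases h0 : ν Set.univ = 0
    · exact ⟨0, by simp [h0]⟩
    have hlt : ν Set.univ - ε < ⨆ M : ℕ, ∫⁻ x, min (f x) M ∂μ := by
      rw [hsup]
      exact ENNReal.sub_lt_self (measure_ne_top _ _) h0 hε
    obtain ⟨M, hM⟩ := lt_iSup_iff.1 hlt
    exact ⟨M, tsub_le_iff_right.1 hM.le⟩
  refine ⟨μ.withDensity fun x => min (f x) M, M, ?_, ?_, ?_⟩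
  · conv_rhs => rw [← hν]
    exact withDensity_mono (ae_of_all _ fun x => min_le_left _ _)
  · rw [← withDensity_const]
    exact withDensity_mono (ae_of_all _ fun x => min_le_right _ _)
  · rwa [withDensity_apply _ .univ, Measure.restrict_univ]

lemma tendsto_pow_comp_sub_invariant {P : Kernel E E} [IsMarkovKernel P]
    (h : ∀ x y : E, ∃ n : ℕ, (P ^ n) x ≪ (P ^ n) y) {μ ν : Measure E} [IsProbabilityMeasure μ]
    [IsProbabilityMeasure ν] (hμ : Kernel.Invariant P μ) (hν : ν ≪ μ) :
    Tendsto (fun n : ℕ => ((P ^ n) ∘ₘ ν - μ) Set.univ) atTop (𝓝 0) := by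
  refine ENNReal.tendsto_nhds_zero.2 fun ε hε => ?_
  have hε2 : ε / 2 ≠ 0 := (ENNReal.half_pos hε.ne').ne'
  obtain ⟨ρ, M, hρν, hρM, hρ⟩ := exists_le_smul_of_absolutelyContinuous hν hε2
  have : IsFiniteMeasure ρ := isFiniteMeasure_of_le ν hρν
  have ha : ρ Set.univ ≤ 1 := (hρν Set.univ).trans_eq measure_univ
  have : IsFiniteMeasure (ρ Set.univ • μ) := μ.smul_finite (measure_ne_top ρ _)
  -- The truncated law ρ is compared with the multiple of μ of the same mass; the bound M + 1
  -- dominates both densities.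
  have hlim := tendsto_pow_comp_sub h (α := ρ) (β := ρ Set.univ • μ) hμ (by simp)
    (M := M + 1) (by finiteness)
    (hρM.trans (by gcongr; exact le_self_add)) (by gcongr; exact ha.trans le_add_self)
  filter_upwards [ENNReal.tendsto_nhds_zero.1 hlim (ε / 2) (pos_iff_ne_zero.2 hε2)] with n hn
  set X := (P ^ n) ∘ₘ ρ - (P ^ n) ∘ₘ (ρ Set.univ • μ) with hX
  have hle : (P ^ n) ∘ₘ ν - μ ≤ X + (P ^ n) ∘ₘ (ν - ρ) := by
    refine Measure.sub_le_of_le_add ?_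
    calc (P ^ n) ∘ₘ ν ≤ (P ^ n) ∘ₘ (ν - ρ) + (P ^ n) ∘ₘ ρ := by
          rw [← Measure.comp_add]; exact comp_mono _ (le_sub_add _ _)
      _ ≤ (P ^ n) ∘ₘ (ν - ρ) + (X + (P ^ n) ∘ₘ (ρ Set.univ • μ)) := by
          gcongr; exact le_sub_add _ _
      _ ≤ (P ^ n) ∘ₘ (ν - ρ) + (X + μ) := by
          rw [Measure.comp_smul, invariant_pow hμ]
          gcongr
          calc ρ Set.univ • μ ≤ (1 : ℝ≥0∞) • μ := by gcongr
            _ = μ := one_smul _ _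
      _ = X + (P ^ n) ∘ₘ (ν - ρ) + μ := by abel
  calc ((P ^ n) ∘ₘ ν - μ) Set.univ ≤ X Set.univ + ((P ^ n) ∘ₘ (ν - ρ)) Set.univ := hle Set.univ
    _ ≤ ε / 2 + ε / 2 := by
      gcongr
      rw [comp_univ, Measure.sub_apply .univ hρν, tsub_le_iff_left]
      exact hρ
    _ = ε := ENNReal.add_halves ε

/-- Doob's theorem for Markov chains: convergence to the invariant probability measure. -/
theorem tendsto_pow_apply_sub {P : Kernel E E} [IsMarkovKernel P]
    (h : ∀ x y : E, ∃ n : ℕ, (P ^ n) x ≪ (P ^ n) y) {μ : Measure E} [IsProbabilityMeasure μ]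
    (hμ : Kernel.Invariant P μ) (x : E) :
    Tendsto (fun n : ℕ => ((P ^ n) x - μ) Set.univ) atTop (𝓝 0) := by
  obtain ⟨N, hN⟩ := exists_pow_absolutelyContinuous h hμ x
  rw [← tendsto_add_atTop_iff_nat N]
  simpa only [add_comm _ N, pow_add_apply] using tendsto_pow_comp_sub_invariant h hμ hN

lemma sub_univ_le_add (μ ν ρ : Measure E) [IsFiniteMeasure μ] [IsFiniteMeasure ν]
    [IsFiniteMeasure ρ] :
    (μ - ν) Set.univ ≤ (μ - ρ) Set.univ + (ρ - ν) Set.univ := by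
  have : μ - ν ≤ μ - ρ + (ρ - ν) := by
    refine Measure.sub_le_of_le_add ((le_sub_add μ ρ).trans ?_)
    rw [add_assoc]
    gcongr
    exact le_sub_add ρ ν
  exact this Set.univ

theorem eq_of_invariant {P : Kernel E E} [IsMarkovKernel P]
    (h : ∀ x y : E, ∃ n : ℕ, (P ^ n) x ≪ (P ^ n) y) {μ ν : Measure E} [IsProbabilityMeasure μ]
    [IsProbabilityMeasure ν] (hμ : Kernel.Invariant P μ) (hν : Kernel.Invariant P ν) : μ = ν := by
  obtain ⟨x⟩ := μ.nonempty_of_neZero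
  refine eq_of_sub_univ_eq_zero (by simp) (le_antisymm ?_ bot_le)
  have hlim := (tendsto_pow_apply_sub h hμ x).add (tendsto_pow_apply_sub h hν x)
  rw [add_zero] at hlim
  refine ge_of_tendsto' hlim fun n => (sub_univ_le_add μ ν ((P ^ n) x)).trans_eq ?_
  rw [sub_univ_comm (μ := μ) (by simp)]

/-! ### Continuous time through the integer skeleton. -/

lemma pow_one_eq {P : ℝ≥0 → Kernel E E} (hP : IsKernelSemigroup P) (n : ℕ) :
    P 1 ^ n = P n := by
  induction n with
  | zero => rw [pow_zero, Nat.cast_zero, hP.zero]; rfl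
  | succ k ih => rw [Kernel.pow_add, ih, pow_one, Nat.cast_add_one, add_comm, hP.add]

lemma skeleton_absolutelyContinuous {P : ℝ≥0 → Kernel E E} (hP : IsKernelSemigroup P) {x y : E}
    (h : ∃ t : ℝ≥0, P t x ≪ P t y) : ∃ n : ℕ, (P 1 ^ n) x ≪ (P 1 ^ n) y := by
  obtain ⟨t, ht⟩ := h
  obtain ⟨n, hn⟩ := exists_nat_ge t
  refine ⟨n, ?_⟩
  -- Evolving both laws for the remaining time n - t preserves absolute continuity.
  rw [pow_one_eq hP, ← add_tsub_cancel_of_le hn, hP.add, Kernel.comp_apply, Kernel.comp_apply]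
  exact ht.comp_right _

lemma antitone_semigroup_sub {P : ℝ≥0 → Kernel E E} [∀ t, IsMarkovKernel (P t)]
    (hP : IsKernelSemigroup P) {μ : Measure E} [IsFiniteMeasure μ]
    (hμ : ∀ t, Kernel.Invariant (P t) μ) (x : E) :
    Antitone fun t : ℝ≥0 => (P t x - μ) Set.univ := by
  intro s t hst
  dsimp only
  conv_lhs => rw [← add_tsub_cancel_of_le hst, hP.add, Kernel.comp_apply, ← (hμ (t - s)).def]
  exact comp_sub_univ_le _ _ _

theorem tendsto_semigroup_sub {P : ℝ≥0 → Kernel E E} [∀ t, IsMarkovKernel (P t)]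
    (hP : IsKernelSemigroup P) (h : ∀ x y : E, ∃ t : ℝ≥0, P t x ≪ P t y) {μ : Measure E}
    [IsProbabilityMeasure μ] (hμ : ∀ t, Kernel.Invariant (P t) μ) (x : E) :
    Tendsto (fun t : ℝ≥0 => (P t x - μ) Set.univ) atTop (𝓝 0) := by
  have hlim := (tendsto_pow_apply_sub (fun x y => skeleton_absolutelyContinuous hP (h x y))
    (hμ 1) x).comp (tendsto_nat_floor_atTop (α := ℝ≥0))
  refine tendsto_of_tendsto_of_tendsto_of_le_of_le tendsto_const_nhds hlim
    (fun _ => bot_le) fun t => ?_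
  simp only [Function.comp_apply, pow_one_eq hP]
  exact antitone_semigroup_sub hP hμ x (Nat.floor_le zero_le)

end MarkovTV

theorem theorem1 {E : Type*} [MeasurableSpace E] [MeasurableSpace.CountablyGenerated E]
    (hdiag : MeasurableSet {p : E × E | p.1 = p.2}) :
    -- discrete time: a Markov chain with one-step transition kernel `P`
    (∀ (P : Kernel E E) [IsMarkovKernel P],
      (∀ x y : E, ∃ n : ℕ, MeasEquiv ((P ^ n) x) ((P ^ n) y)) →
        (∀ (μ ν : Measure E) [IsProbabilityMeasure μ] [IsProbabilityMeasure ν],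
          Kernel.Invariant P μ → Kernel.Invariant P ν → μ = ν) ∧
        (∀ (μ : Measure E) [IsProbabilityMeasure μ], Kernel.Invariant P μ →
          ∀ x : E, Tendsto (fun n : ℕ => tvDist ((P ^ n) x) μ) atTop (𝓝 0))) ∧
    -- continuous time: a Markov semigroup `(P t)`, `t ≥ 0`
    (∀ (P : ℝ≥0 → Kernel E E) [∀ t, IsMarkovKernel (P t)], IsKernelSemigroup P →
      (∀ x y : E, ∃ t : ℝ≥0, MeasEquiv (P t x) (P t y)) →
        (∀ (μ ν : Measure E) [IsProbabilityMeasure μ] [IsProbabilityMeasure ν],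
          (∀ t, Kernel.Invariant (P t) μ) → (∀ t, Kernel.Invariant (P t) ν) → μ = ν) ∧
        (∀ (μ : Measure E) [IsProbabilityMeasure μ], (∀ t, Kernel.Invariant (P t) μ) →
          ∀ x : E, Tendsto (fun t : ℝ≥0 => tvDist (P t x) μ) atTop (𝓝 0))) := by
  refine ⟨fun P _ h => ?_, fun P _ hP h => ?_⟩
  · have h' : ∀ x y : E, ∃ n : ℕ, (P ^ n) x ≪ (P ^ n) y := fun x y => (h x y).imp fun _ hn => hn.1
    refine ⟨fun μ ν _ _ hμ hν => MarkovTV.eq_of_invariant h' hμ hν, fun μ _ hμ x => ?_⟩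
    have hlim := ENNReal.Tendsto.const_mul (MarkovTV.tendsto_pow_apply_sub h' hμ x)
      (.inr ENNReal.ofNat_ne_top : (0 : ℝ≥0∞) ≠ 0 ∨ (2 : ℝ≥0∞) ≠ ∞)
    rw [mul_zero] at hlim
    exact hlim.congr fun n => (MarkovTV.tvDist_eq_two_mul (by simp)).symm
  · have h' : ∀ x y : E, ∃ t : ℝ≥0, P t x ≪ P t y := fun x y => (h x y).imp fun _ ht => ht.1
    refine ⟨fun μ ν _ _ hμ hν => MarkovTV.eq_of_invariant
      (fun x y => MarkovTV.skeleton_absolutelyContinuous hP (h' x y)) (hμ 1) (hν 1),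
      fun μ _ hμ x => ?_⟩
    have hlim := ENNReal.Tendsto.const_mul (MarkovTV.tendsto_semigroup_sub hP h' hμ x)
      (.inr ENNReal.ofNat_ne_top : (0 : ℝ≥0∞) ≠ 0 ∨ (2 : ℝ≥0∞) ≠ ∞)
    rw [mul_zero] at hlim
    exact hlim.congr fun t => (MarkovTV.tvDist_eq_two_mul (by simp)).symm
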